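/- Let $n$ be a nonnegative integer and $[n]=\{1,\dots,n\}$. A valuation with ground set $E\subseteq[n]$ is a function $u:2^E\to\mathbb{R}_{\ge 0}$ with $u(\emptyset)=0$ and $u(S)\le u(T)$ whenever $S\subseteq T\subseteq E$; it is understood that $u(T)=u(T\cap E)$ for $T\not\subseteq E$. For a price vector $p\in\mathbb{R}^E$ the demand set $D_u(p)$ is the set of all $T\subseteq E$ that maximize $u(T)-\sum_{i\in T}p_i$, and the face of the regular subdivision $\Delta_u$ of $[0,1]^E$ supported by $p$ is the convex hull of the indicator vectors $e_T$, $T\in D_u(p)$. The valuation $u$ is called gross substitutes if every such face is an $M^\natural$ polytope, that is, a lattice polytope each of whose edges is parallel to $e_i$ or to $e_i-e_j$ for some $i\ne j$ in $E$. The merge (convolution) of valuations $u,v$ with ground sets $E^1,E^2\subseteq[n]$ is the valuation $u*v$ on $E^1\cup E^2$ with $(u*v)(S)=\max_{T\subseteq S}\big(u(T)+v(S\setminus T)\big)$. The endowment of a valuation $u$ on $E$ by $T\subseteq E$ is the valuation $\partial^T u$ on $E\setminus T$ with $\partial^T u(S)=u(S\cup T)-u(T)$. A unit demand valuation on $E\subseteq[n]$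 has the form $u(T)=\max_{i\in T}w_i$ with weights $w\in\mathbb{R}^E_{\ge 0}$ (with $\max\emptyset=0$). The weighted rank of a matroid with ground set $E\subseteq[n]$ and weights $w\in\mathbb{R}^E_{\ge0}$ is $\rho^w(T)=\max\{\sum_{i\in I}w_i : I\subseteq T,\ I \text{ independent}\}$. Let $\mathcal{GSV}_n$ be the set of all gross substitutes valuations whose ground set is some subset of $[n]$. Let $\mathcal{MBV}_n$ (matroid-based valuations) and $\mathcal{EAV}_n$ (endowed assignment valuations) be the smallest classes of valuations with ground set in $[n]$ that are closed under merging and endowment and contain, respectively, all weighted ranks of matroids with ground set a subset of $[n]$, and all unit demand valuations on subsets of $[n]$. Let $\mathcal{OXS}_n$ be the class of all merges of finitely many (at least one) unit demand valuations on subsets of $[n]$. Then for $n\le 3$ every $v\in\mathcal{GSV}_n$ can be written as a merge $u_0*u_1*\dots*u_k$ of finitely many unit demand valuations on subsets of $[n]$, and $$\mathcal{GSV}_n=\mathcal{MBV}_n=\mathcal{EAV}_n=\mathcal{OXS}_n .$$ -/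

import Mathlib

open scoped NNReal

/-- A valuation `u : 2^E → ℝ` whose ground set `E` is a subset of the set `Fin n` of `n` items:
`u ∅ = 0` and `u` is monotone (hence nonnegative). So that valuations with different ground sets
can be compared and merged, `u` is stored as a function on all subsets of `Fin n`, extended from
the subsets of `E` by the rule `u T = u (T ∩ E)`. The values on subsets of `E` determine the
extension, so two such objects are equal exactly if they have the same ground set `E` and the same
values on the subsets of `E`. -/
@[ext]
structure ItemValuation (n : ℕ) where
  ground : Finset (Fin n)
  toFun : Finset (Fin n) → ℝ
  map_inter_ground : ∀ T, toFun (T ∩ ground) = toFun T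
  map_empty : toFun ∅ = 0
  mono : ∀ ⦃S T⦄, S ⊆ T → toFun S ≤ toFun T

namespace ItemValuation

variable {n : ℕ}

/-- Two valuations with the same ground set that agree on its subsets are equal. -/
theorem ext_on_ground {u v : ItemValuation n} (hg : u.ground = v.ground)
    (h : ∀ T ⊆ u.ground, u.toFun T = v.toFun T) : u = v := by
  refine ItemValuation.ext hg (funext fun T => ?_)
  rw [← u.map_inter_ground, h _ Finset.inter_subset_right, hg, v.map_inter_ground]

theorem toFun_congr (u : ItemValuation n) {S T : Finset (Fin n)}
    (h : S ∩ u.ground = T ∩ u.ground) : u.toFun S = u.toFun T := by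
  rw [← u.map_inter_ground S, h, u.map_inter_ground]

/-- Every monotone function on the subsets of `E` which vanishes at `∅` is (the restriction of) a
valuation with ground set `E`. -/
theorem exists_of_monotoneOn (E : Finset (Fin n)) (f : Finset (Fin n) → ℝ) (h0 : f ∅ = 0)
    (hf : ∀ S T, S ⊆ T → T ⊆ E → f S ≤ f T) :
    ∃ u : ItemValuation n, u.ground = E ∧ ∀ T ⊆ E, u.toFun T = f T :=
  ⟨{ ground := E
     toFun := fun T => f (T ∩ E)
     map_inter_ground := fun T => by simp
     map_empty := by simpa using h0
     mono := fun S T h =>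
      hf _ _ (Finset.inter_subset_inter_right h) Finset.inter_subset_right }, rfl,
    fun T hT => by simp [Finset.inter_eq_left.2 hT]⟩

/-- The merge (convolution) `u ∗ v`, with ground set the union of the two ground sets:
`(u ∗ v)(S) = max_{T ⊆ S} (u(T) + v(S \ T))`. -/
noncomputable def merge (u v : ItemValuation n) : ItemValuation n where
  ground := u.ground ∪ v.ground
  toFun S := S.powerset.sup' ⟨∅, Finset.empty_mem_powerset S⟩
    (fun T => u.toFun T + v.toFun (S \ T))
  map_inter_ground S := by
    apply le_antisymm
    · refine Finset.sup'_le _ _ fun T hT => ?_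
      rw [Finset.mem_powerset] at hT
      refine le_trans ?_ (Finset.le_sup' (fun T => u.toFun T + v.toFun (S \ T))
        (Finset.mem_powerset.2 (hT.trans Finset.inter_subset_left)))
      exact add_le_add le_rfl (v.mono (Finset.sdiff_subset_sdiff Finset.inter_subset_left le_rfl))
    · refine Finset.sup'_le _ _ fun T hT => ?_
      rw [Finset.mem_powerset] at hT
      refine le_trans (le_of_eq ?_) (Finset.le_sup'
        (fun T => u.toFun T + v.toFun ((S ∩ (u.ground ∪ v.ground)) \ T))
        (Finset.mem_powerset.2
          (Finset.inter_subset_inter_right (u := u.ground ∪ v.ground) hT)))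
      congr 1
      · apply u.toFun_congr
        ext i; simp only [Finset.mem_inter, Finset.mem_union]; tauto
      · apply v.toFun_congr
        ext i; simp only [Finset.mem_inter, Finset.mem_union, Finset.mem_sdiff]; tauto
  map_empty := by simp [u.map_empty, v.map_empty]
  mono S S' h := by
    refine Finset.sup'_le _ _ fun T hT => ?_
    rw [Finset.mem_powerset] at hT
    refine le_trans ?_ (Finset.le_sup' (fun T => u.toFun T + v.toFun (S' \ T))
      (Finset.mem_powerset.2 (hT.trans h)))
    exact add_le_add le_rfl (v.mono (Finset.sdiff_subset_sdiff h le_rfl))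

/-- The endowment `∂^T u` of `u` by `T`, with ground set `E \ T` where `E` is the ground set of
`u`: `∂^T u (S) = u(S ∪ T) - u(T)`. -/
def endow (u : ItemValuation n) (T : Finset (Fin n)) : ItemValuation n where
  ground := u.ground \ T
  toFun S := u.toFun (S ∪ T) - u.toFun T
  map_inter_ground S := by
    congr 1
    apply u.toFun_congr
    ext i; simp only [Finset.mem_inter, Finset.mem_union, Finset.mem_sdiff]; tauto
  map_empty := by simp
  mono S S' h := sub_le_sub_right (u.mono (Finset.union_subset_union_left h)) _

/-- The unit demand valuation on the ground set `E` with weights `w ≥ 0`: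
`u(T) = max_{i ∈ T} w_i` for `T ⊆ E`, the maximum over the empty set being `0`. -/
noncomputable def unitDemand (E : Finset (Fin n)) (w : Fin n → ℝ≥0) : ItemValuation n where
  ground := E
  toFun T := (((T ∩ E).sup w : ℝ≥0) : ℝ)
  map_inter_ground T := by simp
  map_empty := by simp
  mono S T h := by
    exact_mod_cast Finset.sup_mono (Finset.inter_subset_inter_right h)

open Classical in
/-- The weighted rank valuation of a matroid `M` whose ground set is a subset of `Fin n`, with
weights `w ≥ 0`: `ρ^w(T) = max {∑_{i ∈ I} w_i : I ⊆ T, I independent in M}`. -/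
noncomputable def weightedRank (M : Matroid (Fin n)) (w : Fin n → ℝ≥0) : ItemValuation n where
  ground := Finset.univ.filter (fun i => i ∈ M.E)
  toFun T := (((T.powerset.filter (fun I : Finset (Fin n) => M.Indep (I : Set (Fin n)))).sup
    (fun I : Finset (Fin n) => ∑ i ∈ I, w i) : ℝ≥0) : ℝ)
  map_inter_ground T := by
    congr 2
    ext I
    simp only [Finset.mem_filter, Finset.mem_powerset, Finset.subset_inter_iff]
    constructor
    · rintro ⟨h, hI⟩; exact ⟨h.1, hI⟩
    · rintro ⟨h, hI⟩
      refine ⟨⟨h, fun i hi => ?_⟩, hI⟩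
      simpa using hI.subset_ground (Finset.mem_coe.2 hi)
  map_empty := by
    rw [NNReal.coe_eq_zero, ← bot_eq_zero, Finset.sup_eq_bot_iff]
    intro I hI
    simp only [Finset.powerset_empty, Finset.mem_filter, Finset.mem_singleton] at hI
    simp [hI.1]
  mono S T h := by
    exact_mod_cast Finset.sup_mono
      (Finset.filter_subset_filter _ (Finset.powerset_mono.2 h))

/-- The demand set (cell) at the price vector `p`: the bundles `T ⊆ E` that maximize
`u(T) - ∑_{i ∈ T} p_i`. -/
def demand (u : ItemValuation n) (p : Fin n → ℝ) : Set (Finset (Fin n)) :=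
  {T | T ⊆ u.ground ∧ ∀ S ⊆ u.ground, u.toFun S - ∑ i ∈ S, p i ≤ u.toFun T - ∑ i ∈ T, p i}

end ItemValuation

/-- The indicator vector `e_T ∈ {0,1}^n` of a bundle `T`. -/
def bundleVector {n : ℕ} (T : Finset (Fin n)) : Fin n → ℝ := fun i => if i ∈ T then 1 else 0

/-- The face of the regular subdivision `Δ_u` supported by the price vector `p`: the convex hull
of the demand set at `p`. For a ground set `E ≠ Fin n` the cube `[0,1]^E` is identified with the
face of `[0,1]^n` on which all coordinates outside `E` are zero. -/
def ItemValuation.face {n : ℕ} (u : ItemValuation n) (p : Fin n → ℝ) : Set (Fin n → ℝ) :=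
  convexHull ℝ (bundleVector '' u.demand p)

/-- A lattice polytope: the convex hull of finitely many integer points. -/
def IsLatticePolytope {n : ℕ} (P : Set (Fin n → ℝ)) : Prop :=
  ∃ F : Set (Fin n → ℤ), F.Finite ∧ P = convexHull ℝ ((fun a i => (a i : ℝ)) '' F)

/-- A lattice polytope is M♮ if each of its edges, that is, each of its one-dimensional (exposed)
faces `[x, y]`, is parallel to some `e_i` or to some `e_i - e_j` with `i ≠ j`. -/
def IsMNaturalPolytope {n : ℕ} (P : Set (Fin n → ℝ)) : Prop :=
  IsLatticePolytope P ∧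
    ∀ x y : Fin n → ℝ, x ≠ y → IsExposed ℝ P (segment ℝ x y) →
      (∃ (i : Fin n) (c : ℝ), y - x = c • Pi.single i (1 : ℝ)) ∨
      (∃ (i j : Fin n) (c : ℝ), i ≠ j ∧
        y - x = c • ((Pi.single i (1 : ℝ) : Fin n → ℝ) - Pi.single j (1 : ℝ)))

/-- A valuation is gross substitutes if all faces of its regular subdivision are M♮ polytopes. -/
def ItemValuation.IsGrossSubstitutes {n : ℕ} (u : ItemValuation n) : Prop :=
  ∀ p : Fin n → ℝ, IsMNaturalPolytope (u.face p)

/-- `GSV n`: the gross substitutes valuations whose ground set is some subset of `Fin n`. -/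
def GSV (n : ℕ) : Set (ItemValuation n) := {u | u.IsGrossSubstitutes}

/-- The unit demand valuations whose ground set is some subset of `Fin n`. -/
def UnitDemandVal (n : ℕ) : Set (ItemValuation n) :=
  {u | ∃ (E : Finset (Fin n)) (w : Fin n → ℝ≥0), u = ItemValuation.unitDemand E w}

/-- The weighted ranks of all matroids whose ground set is some subset of `Fin n`. -/
def WeightedRankVal (n : ℕ) : Set (ItemValuation n) :=
  {u | ∃ (M : Matroid (Fin n)) (w : Fin n → ℝ≥0), u = ItemValuation.weightedRank M w}

/-- The smallest class that contains `G` and is closed under merging. -/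
inductive MergeClosure {n : ℕ} (G : Set (ItemValuation n)) : ItemValuation n → Prop
  | base (u : ItemValuation n) : u ∈ G → MergeClosure G u
  | merge (u v : ItemValuation n) : MergeClosure G u → MergeClosure G v →
      MergeClosure G (u.merge v)

/-- The smallest class that contains `G` and is closed under merging and endowment. -/
inductive MergeEndowClosure {n : ℕ} (G : Set (ItemValuation n)) : ItemValuation n → Prop
  | base (u : ItemValuation n) : u ∈ G → MergeEndowClosure G u
  | merge (u v : ItemValuation n) : MergeEndowClosure G u → MergeEndowClosure G v →
      MergeEndowClosure G (u.merge v)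
  | endow (u : ItemValuation n) (T : Finset (Fin n)) : T ⊆ u.ground → MergeEndowClosure G u →
      MergeEndowClosure G (u.endow T)

/-- Matroid-based valuations: generated from the weighted ranks of matroids with ground set in
`Fin n` by merging and endowment. -/
def MBV (n : ℕ) : Set (ItemValuation n) := {u | MergeEndowClosure (WeightedRankVal n) u}

/-- Endowed assignment valuations: generated from the unit demand valuations with ground set in
`Fin n` by merging and endowment. -/
def EAV (n : ℕ) : Set (ItemValuation n) := {u | MergeEndowClosure (UnitDemandVal n) u}

/-- OXS valuations: generated from the unit demand valuations with ground set in `Fin n` by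
merging. -/
def OXS (n : ℕ) : Set (ItemValuation n) := {u | MergeClosure (UnitDemandVal n) u}

/-! On at most three items, being gross substitutes is equivalent to finitely many inequalities
(`LocalGS`): pairwise subadditivity, submodularity over a third item, and an exchange condition.
Applied to all orderings of i, j, k, the exchange condition says that the maximum of u(ij)+u(k),
u(ik)+u(j), u(jk)+u(i) is attained at least twice.

If one of these inequalities fails, suitable prices make exactly two bundles optimal, and the edge
joining them has two coordinates changing with the same sign (`IsGrossSubstitutes.localGS`).
Conversely, an edge with a forbidden direction joins two demanded bundles that the inequalities
replace by another demanded pair with the same midpoint, which is impossible on an edge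
(`LocalGS.isGrossSubstitutes`).

The theorem then follows from the cycle OXS ⊆ EAV ⊆ MBV ⊆ GSV ⊆ OXS. The first two inclusions hold
because unit demand valuations are weighted ranks of matroids of rank at most one. The third holds
because `LocalGS` is true for weighted ranks and survives merging and endowment. For the last,
deficits of pairs and of the triple relative to additivity give explicit weights of at most three
unit demand valuations whose merge is the given valuation (`LocalGS.isUnitDemandMerge`). -/

namespace ItemValuation

variable {n : ℕ}

/-- The local exchange inequalities which characterize gross substitutes valuations on at most
three items. -/
structure LocalGS (u : ItemValuation n) : Prop where
  subadd : ∀ i j, i ≠ j → u.toFun {i, j} ≤ u.toFun {i} + u.toFun {j}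
  submod : ∀ i j k, i ≠ j → i ≠ k → j ≠ k →
    u.toFun {i, j, k} + u.toFun {k} ≤ u.toFun {i, k} + u.toFun {j, k}
  exch : ∀ i j k, i ≠ j → i ≠ k → j ≠ k →
    u.toFun {i, j} + u.toFun {k} ≤ u.toFun {i, k} + u.toFun {j} ∨
    u.toFun {i, j} + u.toFun {k} ≤ u.toFun {j, k} + u.toFun {i}

/-! ### Merging preserves the local inequalities -/

theorem nonneg (u : ItemValuation n) (T : Finset (Fin n)) : 0 ≤ u.toFun T := by
  rw [← u.map_empty]
  exact u.mono (Finset.empty_subset T)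

theorem add_le_merge (u v : ItemValuation n) {S T R : Finset (Fin n)} (hT : T ⊆ S)
    (hR : R ⊆ S) (h : Disjoint T R) : u.toFun T + v.toFun R ≤ (u.merge v).toFun S :=
  le_trans (add_le_add le_rfl (v.mono (Finset.subset_sdiff.2 ⟨hR, h.symm⟩)))
    (Finset.le_sup' (fun T => u.toFun T + v.toFun (S \ T)) (Finset.mem_powerset.2 hT))

theorem exists_merge_eq (u v : ItemValuation n) (S : Finset (Fin n)) :
    ∃ T ⊆ S, (u.merge v).toFun S = u.toFun T + v.toFun (S \ T) := by
  obtain ⟨T, hT, h⟩ := Finset.exists_mem_eq_sup' ⟨∅, Finset.empty_mem_powerset S⟩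
    (fun T => u.toFun T + v.toFun (S \ T))
  exact ⟨T, Finset.mem_powerset.1 hT, h⟩

theorem left_le_merge (u v : ItemValuation n) (S : Finset (Fin n)) :
    u.toFun S ≤ (u.merge v).toFun S := by
  simpa [v.map_empty] using
    add_le_merge u v (subset_refl S) (Finset.empty_subset S) (Finset.disjoint_empty_right S)

theorem right_le_merge (u v : ItemValuation n) (S : Finset (Fin n)) :
    v.toFun S ≤ (u.merge v).toFun S := by
  simpa [u.map_empty] using
    add_le_merge u v (Finset.empty_subset S) (subset_refl S) (Finset.disjoint_empty_left S)

theorem merge_singleton (u v : ItemValuation n) (i : Fin n) :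
    (u.merge v).toFun {i} = u.toFun {i} ∨ (u.merge v).toFun {i} = v.toFun {i} := by
  obtain ⟨T, hT, h⟩ := exists_merge_eq u v {i}
  rcases Finset.subset_singleton_iff.1 hT with rfl | rfl
  · right; simpa [u.map_empty] using h
  · left; simpa [v.map_empty] using h

theorem merge_pair (u v : ItemValuation n) {i j : Fin n} (hij : i ≠ j) :
    (u.merge v).toFun {i, j} = u.toFun {i, j} ∨
    (u.merge v).toFun {i, j} = u.toFun {i} + v.toFun {j} ∨
    (u.merge v).toFun {i, j} = u.toFun {j} + v.toFun {i} ∨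
    (u.merge v).toFun {i, j} = v.toFun {i, j} := by
  obtain ⟨T, hT, h⟩ := exists_merge_eq u v {i, j}
  have hT' : T = ∅ ∨ T = {i} ∨ T = {j} ∨ T = {i, j} := by
    by_cases hi : i ∈ T <;> by_cases hj : j ∈ T
    all_goals grind
  rcases hT' with rfl | rfl | rfl | rfl
  · simp_all [u.map_empty]
  · rw [show ({i, j} : Finset (Fin n)) \ {i} = {j} by grind] at h
    simp [h]
  · rw [show ({i, j} : Finset (Fin n)) \ {j} = {i} by grind] at h
    simp [h]
  · simp_all [v.map_empty]

theorem eq_of_subset_triple {i j k : Fin n} {T : Finset (Fin n)} (hT : T ⊆ {i, j, k}) :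
    T = ∅ ∨ T = {i} ∨ T = {j} ∨ T = {k} ∨ T = {i, j} ∨ T = {i, k} ∨ T = {j, k} ∨
      T = {i, j, k} := by
  rw [← Finset.inter_eq_right.2 hT]
  by_cases hi : i ∈ T <;> by_cases hj : j ∈ T <;> by_cases hk : k ∈ T <;>
    simp [Finset.insert_inter_of_mem, Finset.insert_inter_of_notMem, hi, hj, hk]

theorem merge_triple (u v : ItemValuation n) {i j k : Fin n} (hij : i ≠ j) (hik : i ≠ k)
    (hjk : j ≠ k) :
    (u.merge v).toFun {i, j, k} = u.toFun {i, j, k} ∨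
    (u.merge v).toFun {i, j, k} = u.toFun {i, j} + v.toFun {k} ∨
    (u.merge v).toFun {i, j, k} = u.toFun {i, k} + v.toFun {j} ∨
    (u.merge v).toFun {i, j, k} = u.toFun {j, k} + v.toFun {i} ∨
    (u.merge v).toFun {i, j, k} = u.toFun {i} + v.toFun {j, k} ∨
    (u.merge v).toFun {i, j, k} = u.toFun {j} + v.toFun {i, k} ∨
    (u.merge v).toFun {i, j, k} = u.toFun {k} + v.toFun {i, j} ∨
    (u.merge v).toFun {i, j, k} = v.toFun {i, j, k} := by
  obtain ⟨T, hT, h⟩ := exists_merge_eq u v {i, j, k}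
  rcases eq_of_subset_triple hT with rfl | rfl | rfl | rfl | rfl | rfl | rfl | rfl
  · simp_all [u.map_empty]
  · rw [show ({i, j, k} : Finset (Fin n)) \ {i} = {j, k} by grind] at h
    simp [h]
  · rw [show ({i, j, k} : Finset (Fin n)) \ {j} = {i, k} by grind] at h
    simp [h]
  · rw [show ({i, j, k} : Finset (Fin n)) \ {k} = {i, j} by grind] at h
    simp [h]
  · rw [show ({i, j, k} : Finset (Fin n)) \ {i, j} = {k} by grind] at h
    simp [h]
  · rw [show ({i, j, k} : Finset (Fin n)) \ {i, k} = {j} by grind] at h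
    simp [h]
  · rw [show ({i, j, k} : Finset (Fin n)) \ {j, k} = {i} by grind] at h
    simp [h]
  · simp_all [v.map_empty]

theorem add_le_merge_pair (u v : ItemValuation n) {i j : Fin n} (hij : i ≠ j) :
    u.toFun {i} + v.toFun {j} ≤ (u.merge v).toFun {i, j} ∧
    u.toFun {j} + v.toFun {i} ≤ (u.merge v).toFun {i, j} :=
  ⟨add_le_merge u v (by simp) (by simp) (by simpa using hij),
    add_le_merge u v (by simp) (by simp) (by simpa using hij.symm)⟩

/-- The terms on the smaller side of each inequality are attained by explicit splittings between `u`
and `v`. In every combination of splittings, the inequalities for `u` and `v` bound the sum by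
splittings available on the other side. -/
theorem LocalGS.merge {u v : ItemValuation n} (hu : u.LocalGS) (hv : v.LocalGS) :
    (u.merge v).LocalGS where
  subadd i j hij := by
    have := hu.subadd i j hij
    have := hv.subadd i j hij
    have := left_le_merge u v {i}
    have := right_le_merge u v {i}
    have := left_le_merge u v {j}
    have := right_le_merge u v {j}
    rcases merge_pair u v hij with h | h | h | h <;> linarith
  submod i j k hij hik hjk := by
    have := hu.submod i j k hij hik hjk
    have := hv.submod i j k hij hik hjk
    have := hu.subadd i j hij
    have := hv.subadd i j hij
    have := hu.subadd i k hik
    have := hv.subadd i k hik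
    have := hu.subadd j k hjk
    have := hv.subadd j k hjk
    have := left_le_merge u v {i, k}
    have := right_le_merge u v {i, k}
    have := left_le_merge u v {j, k}
    have := right_le_merge u v {j, k}
    have := add_le_merge_pair u v hik
    have := add_le_merge_pair u v hjk
    have := hu.exch i j k hij hik hjk
    have := hv.exch i j k hij hik hjk
    rcases merge_triple u v hij hik hjk with h | h | h | h | h | h | h | h <;>
      rcases merge_singleton u v k with h' | h' <;> grind
  exch i j k hij hik hjk := by
    have := hu.subadd i j hij
    have := hv.subadd i j hij
    have := left_le_merge u v {i, k}
    have := right_le_merge u v {i, k}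
    have := left_le_merge u v {j, k}
    have := right_le_merge u v {j, k}
    have := left_le_merge u v {i}
    have := right_le_merge u v {i}
    have := left_le_merge u v {j}
    have := right_le_merge u v {j}
    have := add_le_merge_pair u v hik
    have := add_le_merge_pair u v hjk
    have := hu.exch i j k hij hik hjk
    have := hv.exch i j k hij hik hjk
    rcases merge_pair u v hij with h | h | h | h <;>
      rcases merge_singleton u v k with h' | h' <;> grind

/-! ### Weighted matroid ranks satisfy the local inequalities -/

theorem exists_weightedRank_eq (M : Matroid (Fin n)) (w : Fin n → ℝ≥0) (T : Finset (Fin n)) :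
    ∃ I ⊆ T, M.Indep I ∧ (weightedRank M w).toFun T = ∑ i ∈ I, (w i : ℝ) := by
  classical
  obtain ⟨I, hI, h⟩ := Finset.exists_mem_eq_sup
    (T.powerset.filter (fun I : Finset (Fin n) => M.Indep (I : Set (Fin n))))
    ⟨∅, by simp⟩ (fun I : Finset (Fin n) => ∑ i ∈ I, w i)
  simp only [Finset.mem_filter, Finset.mem_powerset] at hI
  refine ⟨I, hI.1, hI.2, ?_⟩
  rw [← NNReal.coe_sum, ← h]
  simp only [weightedRank]

theorem sum_le_weightedRank {M : Matroid (Fin n)} {w : Fin n → ℝ≥0} {I T : Finset (Fin n)}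
    (hI : M.Indep I) (hT : I ⊆ T) : ∑ i ∈ I, (w i : ℝ) ≤ (weightedRank M w).toFun T := by
  classical
  rw [← NNReal.coe_sum]
  simp only [weightedRank, NNReal.coe_le_coe]
  exact Finset.le_sup (f := fun I : Finset (Fin n) => ∑ i ∈ I, w i) (by simp [hI, hT])

theorem weightedRank_union_le (M : Matroid (Fin n)) (w : Fin n → ℝ≥0) (S T : Finset (Fin n)) :
    (weightedRank M w).toFun (S ∪ T) ≤
      (weightedRank M w).toFun S + (weightedRank M w).toFun T := by
  obtain ⟨I, hI, hM, h⟩ := exists_weightedRank_eq M w (S ∪ T)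
  have h1 := sum_le_weightedRank (w := w) (T := S)
    (hM.subset (Finset.coe_subset.2 (Finset.inter_subset_left (s₂ := S))))
    Finset.inter_subset_right
  have h2 := sum_le_weightedRank (w := w) (T := T)
    (hM.subset (Finset.coe_subset.2 (Finset.sdiff_subset (t := S)))) (by grind)
  have h3 := Finset.sum_inter_add_sum_sdiff I S (fun i => (w i : ℝ))
  linarith

theorem exch_weightedRank (M : Matroid (Fin n)) (w : Fin n → ℝ≥0) {i j k : Fin n} (hij : i ≠ j)
    (hik : i ≠ k) (hjk : j ≠ k) :
    (weightedRank M w).toFun {i, j} + (weightedRank M w).toFun {k} ≤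
      (weightedRank M w).toFun {i, k} + (weightedRank M w).toFun {j} ∨
    (weightedRank M w).toFun {i, j} + (weightedRank M w).toFun {k} ≤
      (weightedRank M w).toFun {j, k} + (weightedRank M w).toFun {i} := by
  set f := (weightedRank M w).toFun with hf
  have mono : ∀ ⦃S T⦄, S ⊆ T → f S ≤ f T := (weightedRank M w).mono
  obtain ⟨I, hI, hMI, h1⟩ := exists_weightedRank_eq M w {i, j}
  obtain ⟨J, hJ, hMJ, h2⟩ := exists_weightedRank_eq M w {k}
  rw [← hf] at h1 h2
  by_cases hi : i ∈ I
  swap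
  · left
    have := sum_le_weightedRank (w := w) (T := {j}) hMI (by grind)
    have := mono (show ({k} : Finset (Fin n)) ⊆ {i, k} by simp)
    linarith
  by_cases hj : j ∈ I
  swap
  · right
    have := sum_le_weightedRank (w := w) (T := {i}) hMI (by grind)
    have := mono (show ({k} : Finset (Fin n)) ⊆ {j, k} by simp)
    linarith
  obtain rfl : I = {i, j} := by grind
  -- If `J` is empty, k contributes nothing and subadditivity suffices; only `J = {k}` needs the
  -- matroid exchange axiom.
  rcases Finset.subset_singleton_iff.1 hJ with rfl | rfl
  · left
    have := weightedRank_union_le M w {i} {j}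
    have := mono (show ({i} : Finset (Fin n)) ⊆ {i, k} by simp)
    rw [show ({i} ∪ {j} : Finset (Fin n)) = {i, j} from rfl] at *
    simp at h2
    linarith
  · have hw : ∀ x : Fin n, x ≠ k → M.Indep (insert x ({k} : Finset (Fin n)) : Set (Fin n)) →
        (w x : ℝ) + w k ≤ f {x, k} := by
      intro x hx h
      have := sum_le_weightedRank (w := w) (I := {x, k}) (T := {x, k}) (by simpa using h) le_rfl
      simpa [Finset.sum_pair hx] using this
    have hs : ∀ x ∈ ({i, j} : Finset (Fin n)), (w x : ℝ) ≤ f {x} := by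
      intro x hx
      have := sum_le_weightedRank (w := w) (I := {x}) (T := {x})
        (hMI.subset (Finset.coe_subset.2 (Finset.singleton_subset_iff.2 hx))) le_rfl
      simpa using this
    -- Augmenting {k} from {i, j} decides which alternative holds: x joins k, and the other item of
    -- the pair stays alone.
    obtain ⟨x, hx, hx'⟩ := hMJ.augment hMI (by
      rw [Set.encard_coe_eq_coe_finsetCard, Set.encard_coe_eq_coe_finsetCard,
        Finset.card_pair hij]; simp)
    have h3 := hs i (by simp)
    have h4 := hs j (by simp)
    rw [Finset.sum_pair hij] at h1
    rw [Finset.sum_singleton] at h2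
    have : x = i ∨ x = j := by simpa using hx.1
    rcases this with rfl | rfl
    · left
      linarith [hw _ hik hx']
    · right
      linarith [hw _ hjk hx']

theorem localGS_weightedRank (M : Matroid (Fin n)) (w : Fin n → ℝ≥0) :
    (weightedRank M w).LocalGS where
  subadd i j hij := weightedRank_union_le M w {i} {j}
  submod i j k hij hik hjk := by
    have mono := (weightedRank M w).mono
    obtain ⟨I, hI, hMI, h1⟩ := exists_weightedRank_eq M w {i, j, k}
    obtain ⟨J, hJ, hMJ, h2⟩ := exists_weightedRank_eq M w {k}
    -- If k lies in an optimal `I`, then `I` is covered by its traces on {i, k} and {j, k}, which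
    -- overlap only in k. Otherwise k adds nothing to {i, j}, and exchange with monotonicity
    -- suffices.
    by_cases hk : k ∈ I
    · have h3 := sum_le_weightedRank (w := w) (T := {i, k})
        (hMI.subset (Finset.coe_subset.2 (Finset.inter_subset_left (s₂ := {i, k}))))
        Finset.inter_subset_right
      have h4 := sum_le_weightedRank (w := w) (T := {j, k})
        (hMI.subset (Finset.coe_subset.2 (Finset.inter_subset_left (s₂ := {j, k}))))
        Finset.inter_subset_right
      have h5 := Finset.sum_union_inter (s₁ := I ∩ {i, k}) (s₂ := I ∩ {j, k})
        (f := fun i => (w i : ℝ))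
      rw [show (I ∩ {i, k}) ∪ (I ∩ {j, k}) = I by grind,
        show (I ∩ {i, k}) ∩ (I ∩ {j, k}) = {k} by grind, Finset.sum_singleton] at h5
      have h6 : ∑ i ∈ J, (w i : ℝ) ≤ w k := by
        rw [← Finset.sum_singleton (fun i => (w i : ℝ)) k]
        exact Finset.sum_le_sum_of_subset_of_nonneg hJ (by simp)
      linarith
    · have h3 := sum_le_weightedRank (w := w) (T := {i, j}) hMI (by grind)
      have := mono (show ({j} : Finset (Fin n)) ⊆ {j, k} by simp)
      have := mono (show ({i} : Finset (Fin n)) ⊆ {i, k} by simp)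
      rcases exch_weightedRank M w hij hik hjk with h | h <;> linarith
  exch i j k hij hik hjk := exch_weightedRank M w hij hik hjk

/-! ### Endowment on at most three items -/

theorem eq_or_eq_or_eq (hn : n ≤ 3) {i j k : Fin n} (hij : i ≠ j) (hik : i ≠ k) (hjk : j ≠ k)
    (l : Fin n) : l = i ∨ l = j ∨ l = k := by
  omega

theorem LocalGS.submodular (hn : n ≤ 3) {u : ItemValuation n} (hu : u.LocalGS)
    (S : Finset (Fin n)) (i j : Fin n) :
    u.toFun ({i, j} ∪ S) + u.toFun S ≤ u.toFun ({i} ∪ S) + u.toFun ({j} ∪ S) := by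
  by_cases hi : i ∈ S
  · rw [show {i, j} ∪ S = {j} ∪ S by grind, show {i} ∪ S = S by grind]
    linarith
  by_cases hj : j ∈ S
  · rw [show {i, j} ∪ S = {i} ∪ S by grind, show {j} ∪ S = S by grind]
  rcases eq_or_ne i j with rfl | hij
  · have := u.mono (show S ⊆ {i} ∪ S by grind)
    simpa using this
  rcases S.eq_empty_or_nonempty with rfl | ⟨k, hk⟩
  · simpa [u.map_empty] using hu.subadd i j hij
  · have hik : i ≠ k := by rintro rfl; exact hi hk
    have hjk : j ≠ k := by rintro rfl; exact hj hk
    -- With at most three items, a nonempty set avoiding i and j is the single remaining item, so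
    -- `submod` covers it.
    obtain rfl : S = {k} := by
      ext l
      rcases eq_or_eq_or_eq hn hij hik hjk l with rfl | rfl | rfl <;> simp_all
    simpa using hu.submod i j k hij hik hjk

/-- The first two conditions are submodularity of `u` over larger sets. A nonempty `T` meets {i, j,
k}, so the exchange condition degenerates to monotonicity or submodularity. -/
theorem LocalGS.endow (hn : n ≤ 3) {u : ItemValuation n} (hu : u.LocalGS) (T : Finset (Fin n)) :
    (u.endow T).LocalGS where
  subadd i j _ := by
    have := hu.submodular hn T i j
    simp only [ItemValuation.endow]
    linarith
  submod i j k _ _ _ := by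
    have := hu.submodular hn ({k} ∪ T) i j
    rw [show {i, j} ∪ ({k} ∪ T) = {i, j, k} ∪ T by grind,
      show {i} ∪ ({k} ∪ T) = {i, k} ∪ T by grind,
      show {j} ∪ ({k} ∪ T) = {j, k} ∪ T by grind] at this
    simp only [ItemValuation.endow]
    linarith
  exch i j k hij hik hjk := by
    simp only [ItemValuation.endow]
    rcases T.eq_empty_or_nonempty with rfl | ⟨l, hl⟩
    · simpa [u.map_empty] using hu.exch i j k hij hik hjk
    have hj := u.mono (show {k} ∪ T ⊆ {j, k} ∪ T by grind)
    have hi := u.mono (show {k} ∪ T ⊆ {i, k} ∪ T by grind)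
    rcases eq_or_eq_or_eq hn hij hik hjk l with rfl | rfl | rfl
    · left
      rw [show {l, j} ∪ T = {j} ∪ T by grind]
      linarith
    · right
      rw [show {i, l} ∪ T = {i} ∪ T by grind]
      linarith
    · left
      have := u.mono (show {i} ∪ T ⊆ {i, l} ∪ T by grind)
      have := hu.submodular hn T i j
      rw [show {l} ∪ T = T by grind]
      linarith

/-! ### Unit demand valuations as weighted ranks -/

theorem exists_weightedRank_eq_unitDemand (E : Finset (Fin n)) (w : Fin n → ℝ≥0) :
    ∃ M : Matroid (Fin n), unitDemand E w = weightedRank M w := by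
  classical
  -- The matroid on `E` whose independent sets have at most one element: a heaviest independent set
  -- is a heaviest single item.
  let M := (IndepMatroid.ofFinset (E : Set (Fin n)) (fun I => I ⊆ E ∧ I.card ≤ 1)
    (by simp) (fun I J hJ hIJ => ⟨hIJ.trans hJ.1, (Finset.card_le_card hIJ).trans hJ.2⟩)
    (by
      intro I J hI hJ hlt
      obtain rfl : I = ∅ := Finset.card_eq_zero.1 (by omega)
      obtain ⟨e, he⟩ : J.Nonempty := Finset.card_pos.1 (by omega)
      exact ⟨e, he, by simp, by simpa using hJ.1 he⟩)
    (fun I hI => Finset.coe_subset.2 hI.1)).matroid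
  have hM : ∀ I : Finset (Fin n), M.Indep I ↔ I ⊆ E ∧ I.card ≤ 1 := by
    intro I
    simp [M]
  refine ⟨M, ext_on_ground (by ext; simp [unitDemand, weightedRank, M]) fun T _ => le_antisymm ?_ ?_⟩
  · rcases (T ∩ E).eq_empty_or_nonempty with h | h
    · simpa [unitDemand, h] using nonneg (weightedRank M w) T
    · obtain ⟨i, hi, h⟩ := Finset.exists_mem_eq_sup (T ∩ E) h w
      rw [Finset.mem_inter] at hi
      have := sum_le_weightedRank (M := M) (w := w) (I := {i}) (T := T) ((hM _).2 (by simp [hi.2]))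
        (by simpa using hi.1)
      simpa [unitDemand, h] using this
  · obtain ⟨I, hI, hMI, h⟩ := exists_weightedRank_eq M w T
    rw [h, unitDemand]
    rw [hM] at hMI
    rcases I.eq_empty_or_nonempty with rfl | ⟨i, hi⟩
    · simp
    · obtain rfl : I = {i} := by
        have := Finset.card_le_one.1 hMI.2
        grind
      simp only [Finset.sum_singleton, NNReal.coe_le_coe]
      exact Finset.le_sup (by simpa using ⟨hI hi, hMI.1 hi⟩)

end ItemValuation

/-! ### From gross substitutes to the local inequalities -/

namespace ItemValuation

variable {n : ℕ}

theorem subset_triple (hn : n ≤ 3) {i j k : Fin n} (hij : i ≠ j) (hik : i ≠ k) (hjk : j ≠ k)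
    (T : Finset (Fin n)) : T ⊆ {i, j, k} := by
  intro l _
  simpa using eq_or_eq_or_eq hn hij hik hjk l

/-- The edges of the faces of a gross substitutes valuation do not increase two coordinates. -/
theorem IsGrossSubstitutes.exists_le_of_mem_sdiff {u : ItemValuation n}
    (hu : u.IsGrossSubstitutes) (p : Fin n → ℝ) {S T : Finset (Fin n)} (hS : S ⊆ u.ground)
    (hT : T ⊆ u.ground) {i j : Fin n} (hij : i ≠ j) (hi : i ∈ T \ S) (hj : j ∈ T \ S)
    (hST : u.toFun S - ∑ x ∈ S, p x = u.toFun T - ∑ x ∈ T, p x) :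
    ∃ R ⊆ u.ground, R ≠ S ∧ R ≠ T ∧ u.toFun T - ∑ x ∈ T, p x ≤ u.toFun R - ∑ x ∈ R, p x := by
  by_contra! hR
  have hle : ∀ R ⊆ u.ground, u.toFun R - ∑ x ∈ R, p x ≤ u.toFun T - ∑ x ∈ T, p x := by
    intro R hRg
    by_cases h1 : R = S
    · rw [h1, hST]
    by_cases h2 : R = T
    · rw [h2]
    exact (hR R hRg h1 h2).le
  have hd : u.demand p = {S, T} := by
    ext R
    simp only [demand, Set.mem_ofPred_eq, Set.mem_insert_iff, Set.mem_singleton_iff]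
    constructor
    · rintro ⟨hRg, h⟩
      by_contra! hne
      exact absurd (h T hT) (not_le.2 (hR R hRg hne.1 hne.2))
    · rintro (rfl | rfl)
      · exact ⟨hS, fun R hRg => hST ▸ hle R hRg⟩
      · exact ⟨hT, hle⟩
  rw [Finset.mem_sdiff] at hi hj
  have hdi : (bundleVector T - bundleVector S : Fin n → ℝ) i = 1 := by simp [bundleVector, hi]
  have hdj : (bundleVector T - bundleVector S : Fin n → ℝ) j = 1 := by simp [bundleVector, hj]
  have hne : bundleVector S ≠ bundleVector T := by
    intro h
    simp [h] at hdi
  have hface : u.face p = segment ℝ (bundleVector S) (bundleVector T) := by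
    rw [face, hd, Set.image_pair, convexHull_pair]
  -- With no competing bundle the face is the segment itself. Its direction has entry 1 at both i
  -- and j, hence is parallel to no allowed vector.
  rcases (hu p).2 _ _ hne (hface ▸ IsExposed.refl _) with ⟨a, c, h⟩ | ⟨a, b, c, hab, h⟩
  · rw [h] at hdi hdj
    simp only [Pi.smul_apply, Pi.single_apply, smul_eq_mul] at hdi hdj
    grind
  · rw [h] at hdi hdj
    simp only [Pi.smul_apply, Pi.sub_apply, Pi.single_apply, smul_eq_mul] at hdi hdj
    grind

theorem toFun_insert_of_notMem (u : ItemValuation n) {i : Fin n} (hi : i ∉ u.ground)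
    (T : Finset (Fin n)) : u.toFun (insert i T) = u.toFun T :=
  u.toFun_congr (by rw [Finset.insert_inter_of_notMem hi])

theorem toFun_singleton_of_notMem (u : ItemValuation n) {i : Fin n} (hi : i ∉ u.ground) :
    u.toFun {i} = 0 := by
  rw [← u.map_empty]
  exact u.toFun_insert_of_notMem hi ∅

theorem IsGrossSubstitutes.subadd {u : ItemValuation n} (hu : u.IsGrossSubstitutes) {i j : Fin n}
    (hij : i ≠ j) : u.toFun {i, j} ≤ u.toFun {i} + u.toFun {j} := by
  by_cases hi : i ∈ u.ground
  swap
  · rw [toFun_insert_of_notMem u hi]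
    linarith [u.nonneg {i}]
  by_cases hj : j ∈ u.ground
  swap
  · rw [Finset.pair_comm, toFun_insert_of_notMem u hj]
    linarith [u.nonneg {j}]
  by_contra! hlt
  -- Half the violation is added to each singleton value, so that ∅ and {i, j} tie at utility 0
  -- while {i} and {j} have utility -e. Every other item costs more than any bundle is worth.
  set e := (u.toFun {i, j} - u.toFun {i} - u.toFun {j}) / 2 with he
  set p : Fin n → ℝ := fun l =>
    if l = i then u.toFun {i} + e else if l = j then u.toFun {j} + e
    else u.toFun Finset.univ + 1 with hp
  have hpi : p i = u.toFun {i} + e := by simp [hp]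
  have hpj : p j = u.toFun {j} + e := by simp [hp, hij.symm]
  have hpos : ∀ l, 0 ≤ p l := by
    intro l
    have := u.nonneg {i}
    have := u.nonneg {j}
    have := u.nonneg Finset.univ
    simp only [hp]
    split_ifs <;> linarith
  obtain ⟨R, -, h1, h2, h3⟩ := hu.exists_le_of_mem_sdiff p (S := ∅) (T := {i, j}) (by simp)
    (by simp [Finset.insert_subset_iff, hi, hj]) hij (by simp) (by simp)
    (by rw [Finset.sum_pair hij, hpi, hpj]; simp [u.map_empty]; linarith)
  rw [Finset.sum_pair hij, hpi, hpj] at h3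
  by_cases hl : ∃ l ∈ R, l ≠ i ∧ l ≠ j
  · obtain ⟨l, hlR, hli, hlj⟩ := hl
    have h4 := Finset.single_le_sum (fun x _ => hpos x) hlR
    have h5 := u.mono (Finset.subset_univ R)
    have h6 : p l = u.toFun Finset.univ + 1 := by simp [hp, hli, hlj]
    linarith
  · have hR : R = {i} ∨ R = {j} := by
      by_cases hi : i ∈ R <;> by_cases hj : j ∈ R
      all_goals grind
    rcases hR with rfl | rfl
    · rw [Finset.sum_singleton, hpi] at h3
      linarith
    · rw [Finset.sum_singleton, hpj] at h3
      linarith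

theorem IsGrossSubstitutes.submod (hn : n ≤ 3) {u : ItemValuation n}
    (hu : u.IsGrossSubstitutes) {i j k : Fin n} (hij : i ≠ j) (hik : i ≠ k) (hjk : j ≠ k) :
    u.toFun {i, j, k} + u.toFun {k} ≤ u.toFun {i, k} + u.toFun {j, k} := by
  by_cases hi : i ∈ u.ground
  swap
  · rw [toFun_insert_of_notMem u hi, toFun_insert_of_notMem u hi, add_comm]
  by_cases hj : j ∈ u.ground
  swap
  · rw [Finset.insert_comm, toFun_insert_of_notMem u hj, toFun_insert_of_notMem u hj]
  by_cases hk : k ∈ u.ground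
  swap
  · rw [show ({i, j, k} : Finset (Fin n)) = {k, i, j} by grind, Finset.pair_comm i k,
      Finset.pair_comm j k, toFun_insert_of_notMem u hk, toFun_insert_of_notMem u hk,
      toFun_insert_of_notMem u hk, toFun_singleton_of_notMem u hk, add_zero]
    exact hu.subadd hij
  by_contra! hlt
  -- Items i and j cost their marginal values over {k} plus half the violation, so {k} and {i, j, k}
  -- tie and {i, k}, {j, k} fall short by e. The price -1 of k makes each bundle without k worse
  -- than the same bundle with k.
  set e := (u.toFun {i, j, k} + u.toFun {k} - u.toFun {i, k} - u.toFun {j, k}) / 2 with he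
  set p : Fin n → ℝ := fun l =>
    if l = i then u.toFun {i, k} - u.toFun {k} + e
    else if l = j then u.toFun {j, k} - u.toFun {k} + e else -1 with hp
  have hpi : p i = u.toFun {i, k} - u.toFun {k} + e := by simp [hp]
  have hpj : p j = u.toFun {j, k} - u.toFun {k} + e := by simp [hp, hij.symm]
  have hpk : p k = -1 := by simp [hp, hik.symm, hjk.symm]
  have hs : ∑ x ∈ {i, j, k}, p x = p i + (p j + p k) := by
    rw [Finset.sum_insert (by simp [hij, hik]), Finset.sum_pair hjk]
  obtain ⟨R, -, h1, h2, h3⟩ := hu.exists_le_of_mem_sdiff p (S := {k}) (T := {i, j, k})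
    (by simpa) (by simp [Finset.insert_subset_iff, hi, hj, hk]) hij (by simp [hik])
    (by simp [hjk]) (by rw [hs, Finset.sum_singleton]; linarith)
  rw [hs] at h3
  have := u.mono (show ({i} : Finset (Fin n)) ⊆ {i, k} by simp)
  have := u.mono (show ({j} : Finset (Fin n)) ⊆ {j, k} by simp)
  have := u.mono (show ({i, j} : Finset (Fin n)) ⊆ {i, j, k} by grind)
  have := u.nonneg {k}
  rcases eq_of_subset_triple (subset_triple hn hij hik hjk R) with
    rfl | rfl | rfl | rfl | rfl | rfl | rfl | rfl
  · simp only [Finset.sum_empty, u.map_empty] at h3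
    linarith
  · rw [Finset.sum_singleton] at h3
    linarith
  · rw [Finset.sum_singleton] at h3
    linarith
  · exact h1 rfl
  · rw [Finset.sum_pair hij] at h3
    linarith
  · rw [Finset.sum_pair hik] at h3
    linarith
  · rw [Finset.sum_pair hjk] at h3
    linarith
  · exact h2 rfl

theorem IsGrossSubstitutes.exch (hn : n ≤ 3) {u : ItemValuation n}
    (hu : u.IsGrossSubstitutes) {i j k : Fin n} (hij : i ≠ j) (hik : i ≠ k) (hjk : j ≠ k) :
    u.toFun {i, j} + u.toFun {k} ≤ u.toFun {i, k} + u.toFun {j} ∨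
    u.toFun {i, j} + u.toFun {k} ≤ u.toFun {j, k} + u.toFun {i} := by
  have mi := u.mono (show ({k} : Finset (Fin n)) ⊆ {i, k} by simp)
  have mj := u.mono (show ({k} : Finset (Fin n)) ⊆ {j, k} by simp)
  have mi' := u.mono (show ({i} : Finset (Fin n)) ⊆ {i, k} by simp)
  by_cases hi : i ∈ u.ground
  swap
  · left
    rw [toFun_insert_of_notMem u hi]
    linarith
  by_cases hj : j ∈ u.ground
  swap
  · right
    rw [Finset.pair_comm, toFun_insert_of_notMem u hj]
    linarith
  have hij' := hu.subadd hij
  by_cases hk : k ∈ u.ground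
  swap
  · left
    have := toFun_singleton_of_notMem u hk
    linarith
  have hik' := hu.subadd hik
  by_contra! hlt
  obtain ⟨hlt1, hlt2⟩ := hlt
  have hjki := hu.submod hn hjk hij.symm hik.symm
  rw [show ({j, k, i} : Finset (Fin n)) = {i, j, k} by grind, Finset.pair_comm j i,
    Finset.pair_comm k i] at hjki
  -- The bound is on 2e rather than e because of the bundle {i, j, k}: its utility is compared using
  -- `hjki`, which leaves a slack of 2e.
  obtain ⟨e, he, he1, he2⟩ : ∃ e > 0,
      2 * e < u.toFun {i, j} + u.toFun {k} - u.toFun {i, k} - u.toFun {j} ∧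
      2 * e < u.toFun {i, j} + u.toFun {k} - u.toFun {j, k} - u.toFun {i} := by
    obtain ⟨a, ha, ha'⟩ := exists_between (lt_min (sub_pos.2 hlt1) (sub_pos.2 hlt2))
    rw [lt_min_iff] at ha'
    exact ⟨a / 2, by linarith, by linarith, by linarith⟩
  -- The prices of i and j lie e below their marginal values in {i, j}, so {i, j} beats {i} and {j}
  -- by e. The price of k is then the one that makes {k} tie with {i, j}.
  set p : Fin n → ℝ := fun l =>
    if l = i then u.toFun {i, j} - u.toFun {j} - e
    else if l = j then u.toFun {i, j} - u.toFun {i} - e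
    else u.toFun {k} - (u.toFun {i} + u.toFun {j} - u.toFun {i, j} + 2 * e) with hp
  have hpi : p i = u.toFun {i, j} - u.toFun {j} - e := by simp [hp]
  have hpj : p j = u.toFun {i, j} - u.toFun {i} - e := by simp [hp, hij.symm]
  have hpk : p k = u.toFun {k} - (u.toFun {i} + u.toFun {j} - u.toFun {i, j} + 2 * e) := by
    simp [hp, hik.symm, hjk.symm]
  obtain ⟨R, -, h1, h2, h3⟩ := hu.exists_le_of_mem_sdiff p (S := {k}) (T := {i, j})
    (by simpa) (by simp [Finset.insert_subset_iff, hi, hj]) hij (by simp [hik])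
    (by simp [hjk]) (by rw [Finset.sum_pair hij, Finset.sum_singleton]; linarith)
  rw [Finset.sum_pair hij] at h3
  rcases eq_of_subset_triple (subset_triple hn hij hik hjk R) with
    rfl | rfl | rfl | rfl | rfl | rfl | rfl | rfl
  · simp only [Finset.sum_empty, u.map_empty] at h3
    linarith
  · rw [Finset.sum_singleton] at h3
    linarith
  · rw [Finset.sum_singleton] at h3
    linarith
  · exact h1 rfl
  · exact h2 rfl
  · rw [Finset.sum_pair hik] at h3
    linarith
  · rw [Finset.sum_pair hjk] at h3
    linarith
  · rw [Finset.sum_insert (by simp [hij, hik]), Finset.sum_pair hjk] at h3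
    linarith

theorem IsGrossSubstitutes.localGS (hn : n ≤ 3) {u : ItemValuation n}
    (hu : u.IsGrossSubstitutes) : u.LocalGS :=
  ⟨fun _ _ => hu.subadd, fun _ _ _ => hu.submod hn, fun _ _ _ => hu.exch hn⟩

/-! ### From the local inequalities to gross substitutes -/

/-- At most one item lies outside {i, j}, so `T` is empty or that item, and each case is one local
inequality. Preserving union and intersection keeps both the total price and the sum of indicator
vectors. -/
theorem LocalGS.exists_exchange (hn : n ≤ 3) {u : ItemValuation n} (hu : u.LocalGS)
    {S T : Finset (Fin n)} {i j : Fin n} (hij : i ≠ j) (hi : i ∈ S \ T) (hj : j ∈ S \ T) :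
    ∃ S' T', S' ∪ T' = S ∪ T ∧ S' ∩ T' = S ∩ T ∧ S' ≠ S ∧ S' ≠ T ∧
      u.toFun S + u.toFun T ≤ u.toFun S' + u.toFun T' := by
  rw [Finset.mem_sdiff] at hi hj
  by_cases hk : ∃ k, i ≠ k ∧ j ≠ k
  · obtain ⟨k, hik, hjk⟩ := hk
    have hT : T = ∅ ∨ T = {k} := by
      rcases eq_of_subset_triple (subset_triple hn hij hik hjk T) with
        rfl | rfl | rfl | rfl | rfl | rfl | rfl | rfl <;> simp_all
    have hS : S = {i, j} ∨ S = {i, j, k} := by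
      rcases eq_of_subset_triple (subset_triple hn hij hik hjk S) with
        rfl | rfl | rfl | rfl | rfl | rfl | rfl | rfl <;> simp_all
    have h1 := hu.subadd i j hij
    have h2 := hu.subadd j k hjk
    have h3 := hu.submod i j k hij hik hjk
    have h4 := hu.submod i k j hik hij hjk.symm
    have h5 := hu.exch i j k hij hik hjk
    rcases hS with rfl | rfl <;> rcases hT with rfl | rfl
    · exact ⟨{i}, {j}, by grind, by grind, by grind, by grind, by simpa [u.map_empty] using h1⟩
    · rcases h5 with h5 | h5
      · exact ⟨{i, k}, {j}, by grind, by grind, by grind, by grind, h5⟩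
      · exact ⟨{j, k}, {i}, by grind, by grind, by grind, by grind, h5⟩
    · refine ⟨{k}, {i, j}, by grind, by grind, by grind, by simp, ?_⟩
      rw [Finset.pair_comm k j] at h4
      linarith [u.map_empty, Finset.pair_comm k j]
    · exact ⟨{i, k}, {j, k}, by grind, by grind, by grind, by grind, h3⟩
  · push Not at hk
    obtain rfl : S = {i, j} := by
      ext l
      have := hk l
      grind
    obtain rfl : T = ∅ := by
      ext l
      have := hk l
      grind
    exact ⟨{i}, {j}, by grind, by grind, by grind, by grind,
      by simpa [u.map_empty] using hu.subadd i j hij⟩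

theorem bundleVector_union_add_inter (S T : Finset (Fin n)) :
    bundleVector (S ∪ T) + bundleVector (S ∩ T) = bundleVector S + bundleVector T := by
  ext x
  by_cases hS : x ∈ S <;> by_cases hT : x ∈ T <;> simp [bundleVector, hS, hT]

theorem eq_or_eq_of_bundleVector_mem_segment {R S T : Finset (Fin n)}
    (h : bundleVector R ∈ segment ℝ (bundleVector S) (bundleVector T)) : R = S ∨ R = T := by
  obtain ⟨a, b, ha, hb, hab, h⟩ := h
  have hx : ∀ x, a * (if x ∈ S then 1 else 0) + b * (if x ∈ T then 1 else 0) =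
      if x ∈ R then 1 else 0 := fun x => by simpa [bundleVector] using congrFun h x
  rcases eq_or_ne a 0 with rfl | ha0
  · right
    ext x
    have := hx x
    grind
  rcases eq_or_ne b 0 with rfl | hb0
  · left
    ext x
    have := hx x
    grind
  -- With both coefficients nonzero, a coordinate where `S` and `T` differ would be fractional;
  -- hence all three sets agree.
  left
  ext x
  have := hx x
  grind

theorem left_mem_extremePoints_segment {x y : Fin n → ℝ} (hxy : x ≠ y) :
    x ∈ (segment ℝ x y).extremePoints ℝ := by
  rw [mem_extremePoints_iff_left]
  refine ⟨left_mem_segment ℝ x y, ?_⟩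
  rintro x₁ h₁ x₂ h₂ ⟨a, b, ha, hb, hab, h⟩
  rw [segment_eq_image'] at h₁ h₂
  obtain ⟨s, ⟨hs, -⟩, rfl⟩ := h₁
  obtain ⟨t, ⟨ht, -⟩, rfl⟩ := h₂
  obtain ⟨i, hi⟩ := Function.ne_iff.1 hxy
  have h0 : (a * s + b * t) * (y i - x i) = 0 := by
    have := congrFun h i
    simp only [Pi.add_apply, Pi.smul_apply, Pi.sub_apply, smul_eq_mul] at this
    linear_combination this - x i * hab
  have h1 : a * s + b * t = 0 := (mul_eq_zero.1 h0).resolve_right (sub_ne_zero.2 (Ne.symm hi))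
  have h2 : a * s = 0 := by nlinarith [mul_nonneg ha.le hs, mul_nonneg hb.le ht]
  simp [(mul_eq_zero.1 h2).resolve_left ha.ne']

theorem IsExposed.extremePoints_face {u : ItemValuation n} {p : Fin n → ℝ} {B : Set (Fin n → ℝ)}
    (h : IsExposed ℝ (u.face p) B) : B.extremePoints ℝ ⊆ bundleVector '' u.demand p :=
  (h.isExtreme.extremePoints_subset_extremePoints).trans extremePoints_convexHull_subset

/-- Otherwise exchange yields two further demanded bundles with the same midpoint. The functional
exposing the edge is then maximal at them too, although an edge contains no indicator vectors
besides its endpoints. -/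
theorem LocalGS.sdiff_subsingleton_of_isExposed (hn : n ≤ 3) {u : ItemValuation n}
    (hu : u.LocalGS) {p : Fin n → ℝ} {S T : Finset (Fin n)} (hS : S ∈ u.demand p)
    (hT : T ∈ u.demand p)
    (h : IsExposed ℝ (u.face p) (segment ℝ (bundleVector S) (bundleVector T))) {i j : Fin n}
    (hi : i ∈ S \ T) (hj : j ∈ S \ T) : i = j := by
  by_contra hij
  obtain ⟨S', T', hun, hin, h1, h2, hle⟩ := hu.exists_exchange hn hij hi hj
  have hsum : ∑ x ∈ S', p x + ∑ x ∈ T', p x = ∑ x ∈ S, p x + ∑ x ∈ T, p x := by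
    rw [← Finset.sum_union_inter, hun, hin, Finset.sum_union_inter]
  have hg : S' ∪ T' ⊆ u.ground := hun ▸ Finset.union_subset hS.1 hT.1
  have hS'g := Finset.union_subset_left hg
  have hT'g := Finset.union_subset_right hg
  -- Total utility does not drop under the exchange and neither new bundle beats the optimum, so
  -- both are optimal.
  have hS' : S' ∈ u.demand p := ⟨hS'g, fun R hR => by
    linarith [hS.2 R hR, hT.2 T' hT'g]⟩
  have hT' : T' ∈ u.demand p := ⟨hT'g, fun R hR => by
    linarith [hT.2 R hR, hS.2 S' hS'g]⟩
  have hmem : ∀ R ∈ u.demand p, bundleVector R ∈ u.face p := fun R hR =>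
    subset_convexHull ℝ _ (Set.mem_image_of_mem _ hR)
  obtain ⟨l, hl⟩ := h ⟨_, left_mem_segment ℝ _ _⟩
  have hlS := (hl ▸ left_mem_segment ℝ (bundleVector S) (bundleVector T)).2
  have hlT := (hl ▸ right_mem_segment ℝ (bundleVector S) (bundleVector T)).2
  have hv : bundleVector S' + bundleVector T' = bundleVector S + bundleVector T := by
    rw [← bundleVector_union_add_inter, hun, hin, bundleVector_union_add_inter]
  have hlv := congrArg l hv
  rw [map_add, map_add] at hlv
  have : bundleVector S' ∈ segment ℝ (bundleVector S) (bundleVector T) := by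
    rw [hl]
    refine ⟨hmem _ hS', fun y hy => ?_⟩
    linarith [hlS y hy, hlT _ (hmem _ hT')]
  rcases eq_or_eq_of_bundleVector_mem_segment this with h | h
  · exact h1 h
  · exact h2 h

theorem isLatticePolytope_face (u : ItemValuation n) (p : Fin n → ℝ) :
    IsLatticePolytope (u.face p) := by
  refine ⟨(fun (T : Finset (Fin n)) i => if i ∈ T then 1 else 0) '' u.demand p,
    (Set.toFinite _).image _, ?_⟩
  rw [face, Set.image_image]
  congr 2
  ext T i
  simp [bundleVector]

theorem LocalGS.isGrossSubstitutes (hn : n ≤ 3) {u : ItemValuation n} (hu : u.LocalGS) :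
    u.IsGrossSubstitutes := by
  refine fun p => ⟨isLatticePolytope_face u p, fun x y hxy h => ?_⟩
  -- Endpoints of an edge are extreme points of the face, hence indicator vectors of demanded
  -- bundles.
  obtain ⟨S, hS, rfl⟩ := IsExposed.extremePoints_face h (left_mem_extremePoints_segment hxy)
  have h' := segment_symm ℝ (bundleVector S) y ▸ h
  obtain ⟨T, hT, rfl⟩ := IsExposed.extremePoints_face h' (left_mem_extremePoints_segment hxy.symm)
  have hST {i j} : i ∈ S \ T → j ∈ S \ T → i = j :=
    hu.sdiff_subsingleton_of_isExposed hn hS hT h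
  have hTS {i j} : i ∈ T \ S → j ∈ T \ S → i = j :=
    hu.sdiff_subsingleton_of_isExposed hn hT hS h'
  simp only [Finset.mem_sdiff] at hST hTS
  rcases (S \ T).eq_empty_or_nonempty with h1 | ⟨i, hi⟩ <;>
    rcases (T \ S).eq_empty_or_nonempty with h2 | ⟨j, hj⟩
  · exact absurd (Finset.sdiff_eq_empty_iff_subset.1 h1 |>.antisymm (Finset.sdiff_eq_empty_iff_subset.1 h2)) (fun h => hxy (by rw [h]))
  · rw [Finset.sdiff_eq_empty_iff_subset] at h1
    refine Or.inl ⟨j, 1, ?_⟩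
    ext x
    simp only [bundleVector, Pi.sub_apply, Pi.smul_apply, Pi.single_apply, smul_eq_mul]
    grind
  · rw [Finset.sdiff_eq_empty_iff_subset] at h2
    refine Or.inl ⟨i, -1, ?_⟩
    ext x
    simp only [bundleVector, Pi.sub_apply, Pi.smul_apply, Pi.single_apply, smul_eq_mul]
    grind
  · refine Or.inr ⟨j, i, 1, by grind, ?_⟩
    ext x
    simp only [bundleVector, Pi.sub_apply, Pi.smul_apply, Pi.single_apply, smul_eq_mul]
    grind

end ItemValuation

/-! ### Decomposition into unit demand valuations -/

namespace ItemValuation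

variable {n : ℕ}

/-- Describing a maximum by its upper bounds serves both directions later: taking c to be the value
itself gives lower estimates, and taking c to be the target gives the upper one. Weights vanishing
off `E` let the ground set drop out. -/
theorem unitDemand_le_iff {E : Finset (Fin n)} {w : Fin n → ℝ≥0} (hw : ∀ i ∉ E, w i = 0)
    {S : Finset (Fin n)} {c : ℝ} :
    (unitDemand E w).toFun S ≤ c ↔ 0 ≤ c ∧ ∀ i ∈ S, (w i : ℝ) ≤ c := by
  constructor
  · intro h
    have hc := (nonneg _ S).trans h
    refine ⟨hc, fun i hi => ?_⟩
    by_cases hE : i ∈ E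
    · refine le_trans ?_ h
      simp only [unitDemand, NNReal.coe_le_coe]
      exact Finset.le_sup (Finset.mem_inter.2 ⟨hi, hE⟩)
    · simpa [hw i hE] using hc
  · rintro ⟨hc, h⟩
    lift c to ℝ≥0 using hc
    simp only [unitDemand, NNReal.coe_le_coe] at h ⊢
    exact Finset.sup_le fun i hi => h i (Finset.mem_inter.1 hi).1

/-- A unit demand valuation profits from at most one item, so by monotonicity of `u` only splittings
handing it nothing or a single item matter. -/
theorem merge_unitDemand_le_iff (u : ItemValuation n) {E : Finset (Fin n)} {w : Fin n → ℝ≥0}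
    (hw : ∀ i ∉ E, w i = 0) {S : Finset (Fin n)} {c : ℝ} :
    (u.merge (unitDemand E w)).toFun S ≤ c ↔
      u.toFun S ≤ c ∧ ∀ i ∈ S, u.toFun (S.erase i) + w i ≤ c := by
  constructor
  · intro h
    refine ⟨(left_le_merge _ _ _).trans h, fun i hi => ?_⟩
    have h1 := ((unitDemand_le_iff hw (S := {i})).1 le_rfl).2 i (by simp)
    have h2 := add_le_merge u (unitDemand E w) (S.erase_subset i)
      (Finset.singleton_subset_iff.2 hi) (by simp)
    linarith
  · rintro ⟨h0, h⟩
    obtain ⟨T, hT, hm⟩ := exists_merge_eq u (unitDemand E w) S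
    rw [hm, ← le_sub_iff_add_le', unitDemand_le_iff hw]
    refine ⟨by linarith [u.mono hT], fun i hi => ?_⟩
    rw [Finset.mem_sdiff] at hi
    have := u.mono (show T ⊆ S.erase i from Finset.subset_erase.2 ⟨hT, hi.2⟩)
    linarith [h i hi.1]

theorem merge_unitDemand_singleton_le_iff (u : ItemValuation n) {E : Finset (Fin n)}
    {w : Fin n → ℝ≥0} (hw : ∀ i ∉ E, w i = 0) (i : Fin n) {c : ℝ} :
    (u.merge (unitDemand E w)).toFun {i} ≤ c ↔ u.toFun {i} ≤ c ∧ (w i : ℝ) ≤ c := by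
  rw [merge_unitDemand_le_iff u hw]
  simp [u.map_empty]

theorem merge_unitDemand_pair_le_iff (u : ItemValuation n) {E : Finset (Fin n)}
    {w : Fin n → ℝ≥0} (hw : ∀ i ∉ E, w i = 0) {i j : Fin n} (hij : i ≠ j) {c : ℝ} :
    (u.merge (unitDemand E w)).toFun {i, j} ≤ c ↔
      u.toFun {i, j} ≤ c ∧ u.toFun {j} + w i ≤ c ∧ u.toFun {i} + w j ≤ c := by
  rw [merge_unitDemand_le_iff u hw]
  simp only [Finset.forall_mem_insert, Finset.mem_singleton, forall_eq]
  rw [show ({i, j} : Finset (Fin n)).erase i = {j} by grind,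
    show ({i, j} : Finset (Fin n)).erase j = {i} by grind]

theorem merge_unitDemand_triple_le_iff (u : ItemValuation n) {E : Finset (Fin n)}
    {w : Fin n → ℝ≥0} (hw : ∀ i ∉ E, w i = 0) {i j k : Fin n} (hij : i ≠ j) (hik : i ≠ k)
    (hjk : j ≠ k) {c : ℝ} :
    (u.merge (unitDemand E w)).toFun {i, j, k} ≤ c ↔ u.toFun {i, j, k} ≤ c ∧
      u.toFun {j, k} + w i ≤ c ∧ u.toFun {i, k} + w j ≤ c ∧ u.toFun {i, j} + w k ≤ c := by
  rw [merge_unitDemand_le_iff u hw]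
  simp only [Finset.forall_mem_insert, Finset.mem_singleton, forall_eq]
  rw [show ({i, j, k} : Finset (Fin n)).erase i = {j, k} by grind,
    show ({i, j, k} : Finset (Fin n)).erase j = {i, k} by grind,
    show ({i, j, k} : Finset (Fin n)).erase k = {i, j} by grind]

/-- `v` is a left-associated merge of finitely many (at least one) unit demand valuations. -/
def IsUnitDemandMerge (v : ItemValuation n) : Prop :=
  ∃ (u : ItemValuation n) (l : List (ItemValuation n)),
    u ∈ UnitDemandVal n ∧ (∀ u' ∈ l, u' ∈ UnitDemandVal n) ∧ v = l.foldl merge u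

/-- Nonnegative weights dominated by the values of single items, as `NNReal` weights that vanish
off the ground set. -/
theorem exists_weights (v : ItemValuation n) (x : Fin n → ℝ) (h0 : ∀ i, 0 ≤ x i)
    (h1 : ∀ i, x i ≤ v.toFun {i}) :
    ∃ w : Fin n → ℝ≥0, (∀ i, (w i : ℝ) = x i) ∧ ∀ i ∉ v.ground, w i = 0 := by
  refine ⟨fun i => ⟨x i, h0 i⟩, fun i => rfl, fun i hi => ?_⟩
  have := h1 i
  rw [toFun_singleton_of_notMem v hi] at this
  exact NNReal.coe_eq_zero.1 (le_antisymm this (h0 i))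

theorem isUnitDemandMerge_of_subsingleton (hn : n ≤ 1) (v : ItemValuation n) :
    v.IsUnitDemandMerge := by
  obtain ⟨a, ha, ha0⟩ := v.exists_weights (fun i => v.toFun {i}) (fun i => v.nonneg _)
    (fun i => le_rfl)
  refine ⟨unitDemand v.ground a, [], ⟨_, _, rfl⟩, by simp, ext_on_ground rfl fun T _ => ?_⟩
  rcases T.eq_empty_or_nonempty with rfl | ⟨i, hi⟩
  · simp [map_empty]
  obtain rfl : T = {i} := by
    ext j
    have : j = i := by omega
    simp [this, hi]
  simp only [List.foldl_nil]
  refine le_antisymm ?_ ((unitDemand_le_iff ha0).2 ⟨v.nonneg _, by simp [ha]⟩)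
  have := ((unitDemand_le_iff ha0 (S := {i})).1 le_rfl).2 i (by simp)
  rwa [ha] at this

theorem LocalGS.isUnitDemandMerge_of_pair {v : ItemValuation n} (hv : v.LocalGS) {i j : Fin n}
    (hij : i ≠ j) (hcov : ∀ l, l = i ∨ l = j) : v.IsUnitDemandMerge := by
  have hsub := hv.subadd i j hij
  have mi := v.mono (show ({i} : Finset (Fin n)) ⊆ {i, j} by simp)
  have mj := v.mono (show ({j} : Finset (Fin n)) ⊆ {i, j} by simp)
  have ni := v.nonneg {i}
  have nj := v.nonneg {j}
  obtain ⟨a, ha, ha0⟩ := v.exists_weights (fun i => v.toFun {i}) (fun i => v.nonneg _)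
    (fun i => le_rfl)
  -- Lowering both singleton values by the deficit v(i)+v(j)-v(ij) makes either assignment of the
  -- two items worth v(ij); monotonicity keeps the weights nonnegative.
  obtain ⟨b, hb, hb0⟩ := v.exists_weights
    (fun l => v.toFun {l} - (v.toFun {i} + v.toFun {j} - v.toFun {i, j}))
    (fun l => by rcases hcov l with rfl | rfl <;> linarith) (fun l => by linarith)
  refine ⟨unitDemand v.ground a, [unitDemand v.ground b], ⟨_, _, rfl⟩, ?_, ?_⟩
  · simpa using ⟨_, _, rfl⟩
  refine ext_on_ground (by simp [ItemValuation.merge, unitDemand]) fun T _ => ?_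
  simp only [List.foldl_cons, List.foldl_nil]
  have hT : T = ∅ ∨ T = {i} ∨ T = {j} ∨ T = {i, j} := by
    have : ∀ l ∈ T, l = i ∨ l = j := fun l _ => hcov l
    by_cases hi : i ∈ T <;> by_cases hj : j ∈ T
    all_goals grind
  set A := unitDemand v.ground a
  have hi := (A.merge_unitDemand_singleton_le_iff hb0 i).1 le_rfl
  have hj := (A.merge_unitDemand_singleton_le_iff hb0 j).1 le_rfl
  have hijm := (A.merge_unitDemand_pair_le_iff hb0 hij).1 le_rfl
  have hAi := ((unitDemand_le_iff ha0 (S := {i})).1 le_rfl).2 i (by simp)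
  have hAj := ((unitDemand_le_iff ha0 (S := {j})).1 le_rfl).2 j (by simp)
  simp only [ha, hb] at hi hj hijm hAi hAj
  rcases hT with rfl | rfl | rfl | rfl
  · simp [map_empty]
  · refine le_antisymm (by linarith) ?_
    simp only [merge_unitDemand_singleton_le_iff _ hb0, A, unitDemand_le_iff ha0,
      Finset.mem_singleton, forall_eq, ha, hb]
    refine ⟨⟨?_, ?_⟩, ?_⟩ <;> linarith
  · refine le_antisymm (by linarith) ?_
    simp only [merge_unitDemand_singleton_le_iff _ hb0, A, unitDemand_le_iff ha0,
      Finset.mem_singleton, forall_eq, ha, hb]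
    refine ⟨⟨?_, ?_⟩, ?_⟩ <;> linarith
  · refine le_antisymm (by linarith) ?_
    simp only [merge_unitDemand_pair_le_iff _ hb0 hij, ← le_sub_iff_add_le, A,
      unitDemand_le_iff ha0, Finset.mem_singleton, forall_eq, Finset.forall_mem_insert, ha, hb]
    refine ⟨⟨?_, ?_, ?_⟩, ⟨?_, ?_⟩, ⟨?_, ?_⟩⟩ <;> linarith

-- In terms of deficits from additivity, the hypotheses say that the pairs ik and jk share the
-- deficit s and that ij has deficit t ≥ s. The first valuation carries the singleton values; the
-- second lowers i, j by t and k by s; the third lowers i, j by r-s and k by r-t, where r is the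
-- deficit of the triple. The cheapest ways to serve ij, ik, jk and ijk then lose exactly t, s, s
-- and r. Submodularity gives r ≥ s+t, so using the third valuation never improves a pair.
set_option maxHeartbeats 800000 in
theorem LocalGS.isUnitDemandMerge_of_triple {v : ItemValuation n} (hv : v.LocalGS) (hn : n ≤ 3)
    {i j k : Fin n} (hij : i ≠ j) (hik : i ≠ k) (hjk : j ≠ k)
    (h : v.toFun {i, k} + v.toFun {j} = v.toFun {j, k} + v.toFun {i})
    (h' : v.toFun {i, j} + v.toFun {k} ≤ v.toFun {i, k} + v.toFun {j}) :
    v.IsUnitDemandMerge := by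
  have hcov := eq_or_eq_or_eq hn hij hik hjk
  have sij := hv.subadd i j hij
  have sik := hv.subadd i k hik
  have sjk := hv.subadd j k hjk
  have bk := hv.submod i j k hij hik hjk
  have bj := hv.submod i k j hik hij hjk.symm
  have bi := hv.submod j k i hjk hij.symm hik.symm
  rw [show ({i, k, j} : Finset (Fin n)) = {i, j, k} by grind, Finset.pair_comm k j] at bj
  rw [show ({j, k, i} : Finset (Fin n)) = {i, j, k} by grind, Finset.pair_comm j i,
    Finset.pair_comm k i] at bi
  have ni := v.nonneg {i}
  have nj := v.nonneg {j}
  have nk := v.nonneg {k}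
  have mij := v.mono (show ({i} : Finset (Fin n)) ⊆ {i, j} by simp)
  have mji := v.mono (show ({j} : Finset (Fin n)) ⊆ {i, j} by simp)
  have mik := v.mono (show ({i} : Finset (Fin n)) ⊆ {i, k} by simp)
  have mki := v.mono (show ({k} : Finset (Fin n)) ⊆ {i, k} by simp)
  have mjk := v.mono (show ({j} : Finset (Fin n)) ⊆ {j, k} by simp)
  have mkj := v.mono (show ({k} : Finset (Fin n)) ⊆ {j, k} by simp)
  have tij := v.mono (show ({i, j} : Finset (Fin n)) ⊆ {i, j, k} by grind)
  have tik := v.mono (show ({i, k} : Finset (Fin n)) ⊆ {i, j, k} by grind)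
  have tjk := v.mono (show ({j, k} : Finset (Fin n)) ⊆ {i, j, k} by grind)
  set s := v.toFun {i} + v.toFun {k} - v.toFun {i, k} with hs
  set t := v.toFun {i} + v.toFun {j} - v.toFun {i, j} with ht
  set r := v.toFun {i} + v.toFun {j} + v.toFun {k} - v.toFun {i, j, k} with hr
  obtain ⟨a, ha, ha0⟩ := v.exists_weights (fun i => v.toFun {i}) (fun i => v.nonneg _)
    (fun i => le_rfl)
  obtain ⟨b, hb, hb0⟩ := v.exists_weights (fun l => v.toFun {l} - if l = k then s else t)
    (fun l => by rcases hcov l with rfl | rfl | rfl <;> simp [*] <;> linarith)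
    (fun l => by split_ifs <;> linarith)
  -- Nonnegativity of these weights is monotonicity from pairs to the triple: v(ij) ≤ v(ijk) for k,
  -- v(jk) ≤ v(ijk) for i and v(ik) ≤ v(ijk) for j.
  obtain ⟨c, hc, hc0⟩ := v.exists_weights
    (fun l => v.toFun {l} - if l = k then r - t else r - s)
    (fun l => by rcases hcov l with rfl | rfl | rfl <;> simp [*] <;> linarith)
    (fun l => by split_ifs <;> linarith)
  refine ⟨unitDemand v.ground a, [unitDemand v.ground b, unitDemand v.ground c], ⟨_, _, rfl⟩,
    ?_, ?_⟩
  · simpa using ⟨⟨_, _, rfl⟩, ⟨_, _, rfl⟩⟩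
  refine ext_on_ground (by simp [ItemValuation.merge, unitDemand]) fun T _ => ?_
  simp only [List.foldl_cons, List.foldl_nil]
  set A := unitDemand v.ground a with hA
  set B := A.merge (unitDemand v.ground b) with hB
  have hAi := ((unitDemand_le_iff ha0 (S := {i})).1 le_rfl).2 i (by simp)
  have hAj := ((unitDemand_le_iff ha0 (S := {j})).1 le_rfl).2 j (by simp)
  have hAk := ((unitDemand_le_iff ha0 (S := {k})).1 le_rfl).2 k (by simp)
  have hBi := (A.merge_unitDemand_singleton_le_iff hb0 i).1 le_rfl
  have hBj := (A.merge_unitDemand_singleton_le_iff hb0 j).1 le_rfl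
  have hBk := (A.merge_unitDemand_singleton_le_iff hb0 k).1 le_rfl
  have hBij := (A.merge_unitDemand_pair_le_iff hb0 hij).1 le_rfl
  have hBik := (A.merge_unitDemand_pair_le_iff hb0 hik).1 le_rfl
  have hBjk := (A.merge_unitDemand_pair_le_iff hb0 hjk).1 le_rfl
  have hai := ha i
  have haj := ha j
  have hak := ha k
  have hbi : (b i : ℝ) = v.toFun {i} - t := by rw [hb, if_neg hik]
  have hbj : (b j : ℝ) = v.toFun {j} - t := by rw [hb, if_neg hjk]
  have hbk : (b k : ℝ) = v.toFun {k} - s := by rw [hb, if_pos rfl]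
  have hci : (c i : ℝ) = v.toFun {i} - (r - s) := by rw [hc, if_neg hik]
  have hcj : (c j : ℝ) = v.toFun {j} - (r - s) := by rw [hc, if_neg hjk]
  have hck : (c k : ℝ) = v.toFun {k} - (r - t) := by rw [hc, if_pos rfl]
  clear ha hb hc
  rw [← hA] at hAi hAj hAk
  rw [← hB] at hBi hBj hBk hBij hBik hBjk
  rcases eq_of_subset_triple (subset_triple hn hij hik hjk T) with
    rfl | rfl | rfl | rfl | rfl | rfl | rfl | rfl
  · simp [map_empty]
  · refine le_antisymm ?_ ?_
    · linarith [left_le_merge B (unitDemand v.ground c) {i}]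
    · simp only [merge_unitDemand_singleton_le_iff _ hc0, merge_unitDemand_singleton_le_iff _ hb0,
        unitDemand_le_iff ha0, hA, hB, Finset.mem_singleton, forall_eq]
      refine ⟨⟨⟨?_, ?_⟩, ?_⟩, ?_⟩ <;> linarith
  · refine le_antisymm ?_ ?_
    · linarith [left_le_merge B (unitDemand v.ground c) {j}]
    · simp only [merge_unitDemand_singleton_le_iff _ hc0, merge_unitDemand_singleton_le_iff _ hb0,
        unitDemand_le_iff ha0, hA, hB, Finset.mem_singleton, forall_eq]
      refine ⟨⟨⟨?_, ?_⟩, ?_⟩, ?_⟩ <;> linarith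
  · refine le_antisymm ?_ ?_
    · linarith [left_le_merge B (unitDemand v.ground c) {k}]
    · simp only [merge_unitDemand_singleton_le_iff _ hc0, merge_unitDemand_singleton_le_iff _ hb0,
        unitDemand_le_iff ha0, hA, hB, Finset.mem_singleton, forall_eq]
      refine ⟨⟨⟨?_, ?_⟩, ?_⟩, ?_⟩ <;> linarith
  · refine le_antisymm ?_ ?_
    · linarith [left_le_merge B (unitDemand v.ground c) {i, j}]
    · simp only [merge_unitDemand_pair_le_iff _ hc0 hij, merge_unitDemand_pair_le_iff _ hb0 hij,
        merge_unitDemand_singleton_le_iff _ hb0, ← le_sub_iff_add_le,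
        unitDemand_le_iff ha0, hA, hB, Finset.mem_singleton, forall_eq, Finset.forall_mem_insert]
      refine ⟨⟨⟨?_, ?_, ?_⟩, ⟨?_, ?_⟩, ?_, ?_⟩, ⟨⟨?_, ?_⟩, ?_⟩, ⟨?_, ?_⟩, ?_⟩ <;> linarith
  · refine le_antisymm ?_ ?_
    · linarith [left_le_merge B (unitDemand v.ground c) {i, k}]
    · simp only [merge_unitDemand_pair_le_iff _ hc0 hik, merge_unitDemand_pair_le_iff _ hb0 hik,
        merge_unitDemand_singleton_le_iff _ hb0, ← le_sub_iff_add_le,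
        unitDemand_le_iff ha0, hA, hB, Finset.mem_singleton, forall_eq, Finset.forall_mem_insert]
      refine ⟨⟨⟨?_, ?_, ?_⟩, ⟨?_, ?_⟩, ?_, ?_⟩, ⟨⟨?_, ?_⟩, ?_⟩, ⟨?_, ?_⟩, ?_⟩ <;> linarith
  · refine le_antisymm ?_ ?_
    · linarith [left_le_merge B (unitDemand v.ground c) {j, k}]
    · simp only [merge_unitDemand_pair_le_iff _ hc0 hjk, merge_unitDemand_pair_le_iff _ hb0 hjk,
        merge_unitDemand_singleton_le_iff _ hb0, ← le_sub_iff_add_le,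
        unitDemand_le_iff ha0, hA, hB, Finset.mem_singleton, forall_eq, Finset.forall_mem_insert]
      refine ⟨⟨⟨?_, ?_, ?_⟩, ⟨?_, ?_⟩, ?_, ?_⟩, ⟨⟨?_, ?_⟩, ?_⟩, ⟨?_, ?_⟩, ?_⟩ <;> linarith
  · refine le_antisymm ?_ ?_
    · have := (B.merge_unitDemand_triple_le_iff hc0 hij hik hjk).1 le_rfl
      linarith
    · simp only [merge_unitDemand_triple_le_iff _ hc0 hij hik hjk,
        merge_unitDemand_triple_le_iff _ hb0 hij hik hjk,
        merge_unitDemand_pair_le_iff _ hb0 hij, merge_unitDemand_pair_le_iff _ hb0 hik,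
        merge_unitDemand_pair_le_iff _ hb0 hjk, ← le_sub_iff_add_le,
        unitDemand_le_iff ha0, hA, hB, Finset.mem_singleton, forall_eq, Finset.forall_mem_insert]
      refine ⟨⟨⟨?_, ?_, ?_, ?_⟩, ⟨?_, ?_, ?_⟩, ⟨?_, ?_, ?_⟩, ?_, ?_, ?_⟩,
        ⟨⟨?_, ?_, ?_⟩, ⟨?_, ?_⟩, ?_, ?_⟩, ⟨⟨?_, ?_, ?_⟩, ⟨?_, ?_⟩, ?_, ?_⟩,
        ⟨⟨?_, ?_, ?_⟩, ⟨?_, ?_⟩, ?_, ?_⟩⟩ <;> linarith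

theorem LocalGS.isUnitDemandMerge (hn : n ≤ 3) {v : ItemValuation n} (hv : v.LocalGS) :
    v.IsUnitDemandMerge := by
  rcases le_or_gt n 1 with h1 | h1
  · exact isUnitDemandMerge_of_subsingleton h1 v
  rcases le_or_gt n 2 with h2 | h2
  · obtain rfl : n = 2 := by omega
    exact hv.isUnitDemandMerge_of_pair (i := 0) (j := 1) (by decide) (by decide)
  obtain rfl : n = 3 := by omega
  have e0 := hv.exch 0 1 2 (by decide) (by decide) (by decide)
  have e1 := hv.exch 0 2 1 (by decide) (by decide) (by decide)
  have e2 := hv.exch 1 2 0 (by decide) (by decide) (by decide)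
  have p01 : v.toFun {1, 0} = v.toFun {0, 1} := congrArg _ (Finset.pair_comm _ _)
  have p02 : v.toFun {2, 0} = v.toFun {0, 2} := congrArg _ (Finset.pair_comm _ _)
  have p12 : v.toFun {2, 1} = v.toFun {1, 2} := congrArg _ (Finset.pair_comm _ _)
  rw [p12] at e1
  rw [p01, p02] at e2
  -- The three exchange conditions force the maximum of the three sums to be attained twice; the
  -- cases name the tied pair, which fixes the relabelling of the items.
  have key : (v.toFun {0, 2} + v.toFun {1} = v.toFun {1, 2} + v.toFun {0} ∧
        v.toFun {0, 1} + v.toFun {2} ≤ v.toFun {0, 2} + v.toFun {1}) ∨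
      (v.toFun {0, 1} + v.toFun {2} = v.toFun {1, 2} + v.toFun {0} ∧
        v.toFun {0, 2} + v.toFun {1} ≤ v.toFun {0, 1} + v.toFun {2}) ∨
      (v.toFun {0, 1} + v.toFun {2} = v.toFun {0, 2} + v.toFun {1} ∧
        v.toFun {1, 2} + v.toFun {0} ≤ v.toFun {0, 1} + v.toFun {2}) := by
    grind
  rcases key with ⟨h, h'⟩ | ⟨h, h'⟩ | ⟨h, h'⟩
  · exact hv.isUnitDemandMerge_of_triple hn (i := 0) (j := 1) (k := 2) (by decide) (by decide)
      (by decide) h h'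
  · exact hv.isUnitDemandMerge_of_triple hn (i := 0) (j := 2) (k := 1) (by decide) (by decide)
      (by decide) (by rwa [p12]) h'
  · exact hv.isUnitDemandMerge_of_triple hn (i := 1) (j := 2) (k := 0) (by decide) (by decide)
      (by decide) (by rwa [p01, p02]) (by rwa [p01])

/-! ### The cycle of inclusions -/

theorem IsUnitDemandMerge.mergeClosure {v : ItemValuation n} (hv : v.IsUnitDemandMerge) :
    MergeClosure (UnitDemandVal n) v := by
  obtain ⟨u, l, hu, hl, rfl⟩ := hv
  have key : ∀ l : List (ItemValuation n), (∀ u' ∈ l, u' ∈ UnitDemandVal n) →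
      ∀ u, MergeClosure (UnitDemandVal n) u → MergeClosure (UnitDemandVal n) (l.foldl merge u) := by
    intro l
    induction l with
    | nil => exact fun _ u hu => hu
    | cons a l ih =>
      intro hl u hu
      rw [List.forall_mem_cons] at hl
      exact ih hl.2 _ (.merge _ _ hu (.base _ hl.1))
  exact key l hl u (.base u hu)

theorem OXS_subset_EAV (n : ℕ) : OXS n ⊆ EAV n := by
  intro u hu
  induction hu with
  | base u hu => exact .base u hu
  | merge u v _ _ hu hv => exact .merge u v hu hv

theorem EAV_subset_MBV (n : ℕ) : EAV n ⊆ MBV n := by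
  intro u hu
  induction hu with
  | base u hu =>
    obtain ⟨E, w, rfl⟩ := hu
    obtain ⟨M, hM⟩ := exists_weightedRank_eq_unitDemand E w
    exact .base _ ⟨M, w, hM⟩
  | merge u v _ _ hu hv => exact .merge u v hu hv
  | endow u T hT _ hu => exact .endow u T hT hu

theorem MBV_subset_GSV (hn : n ≤ 3) : MBV n ⊆ GSV n := by
  intro u hu
  refine LocalGS.isGrossSubstitutes hn ?_
  induction hu with
  | base u hu =>
    obtain ⟨M, w, rfl⟩ := hu
    exact localGS_weightedRank M w
  | merge u v _ _ hu hv => exact hu.merge hv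
  | endow u T _ _ hu => exact hu.endow hn T

end ItemValuation

open ItemValuation in
theorem GSV_subset_OXS {n : ℕ} (hn : n ≤ 3) : GSV n ⊆ OXS n := fun _ hv =>
  (IsGrossSubstitutes.localGS hn hv).isUnitDemandMerge hn |>.mergeClosure

open ItemValuation in
theorem mainTheorem2 (n : ℕ) (hn : n ≤ 3) :
    (∀ v ∈ GSV n, ∃ (u : ItemValuation n) (l : List (ItemValuation n)),
      u ∈ UnitDemandVal n ∧ (∀ u' ∈ l, u' ∈ UnitDemandVal n) ∧
        v = l.foldl ItemValuation.merge u) ∧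
    GSV n = MBV n ∧ MBV n = EAV n ∧ EAV n = OXS n := by
  have h1 := GSV_subset_OXS hn
  have h2 := OXS_subset_EAV n
  have h3 := EAV_subset_MBV n
  have h4 := MBV_subset_GSV hn
  exact ⟨fun v hv => (IsGrossSubstitutes.localGS hn hv).isUnitDemandMerge hn,
    (h1.trans (h2.trans h3)).antisymm h4, (h4.trans (h1.trans h2)).antisymm h3,
    (h3.trans (h4.trans h1)).antisymm h2⟩
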